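/- Let $n\ge 1$, $\epsilon_0\ge 0$ and $\lambda>1$. For probability measures $U,V$ on the same measurable space let $$D^\lambda(U\|V)=\frac1{\lambda-1}\log \mathbb E_{x\sim V}\Big[\Big(\frac{dU}{dV}(x)\Big)^\lambda\Big]\in[0,\infty]$$ be the Rényi divergence of order $\lambda$, with $D^\lambda(U\|V)=\infty$ if $U$ is not absolutely continuous with respect to $V$. Let $\mathcal D$ be a set, let $\mathcal S^{(1)},\dots,\mathcal S^{(n)}$ be measurable spaces, and for $i\in[n]$ let $\mathcal R^{(i)}:\mathcal S^{(1)}\times\cdots\times\mathcal S^{(i-1)}\times\mathcal D\to\mathcal S^{(i)}$ be a randomized algorithm (for each fixed $x\in\mathcal D$, a Markov kernel $z_{1:i-1}\mapsto\mathcal R^{(i)}(z_{1:i-1},x)$). Suppose that for every $i$ and every $z_{1:i-1}$ the randomizer $\mathcal R^{(i)}(z_{1:i-1},\cdot)$ is $\epsilon_0$-LDP, that is, $$\mathbb P(\mathcal R^{(i)}(z_{1:i-1},x)\in E)\le e^{\epsilon_0}\,\mathbb P(\mathcal R^{(i)}(z_{1:i-1},x')\in E)$$ for all $x,x'\in\mathcal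 D$ and all measurable $E\subseteq \mathcal S^{(i)}$. Let $\mathcal A_{R,S}$ be the shuffled adaptive process: on input $X=(x_1,\dots,x_n)\in\mathcal D^n$ it draws a uniformly random permutation $\pi$ of $[n]$, computes successively $z_i=\mathcal R^{(i)}(z_{1:i-1},x_{\pi(i)})$ for $i=1,\dots,n$, and outputs $z_{1:n}$. Put $p=e^{-\epsilon_0}$, let $C\sim \mathrm{Bin}(n-1,p)$, let $A\sim\mathrm{Bin}(C,1/2)$ given $C$, and let $\Delta\sim\mathrm{Bern}\big(\frac1{1+p}\big)$ be independent of $(A,C)$. Let $P$ be the law of $(A+\Delta,\;C-A+1-\Delta)$ and $Q$ the law of $(A+1-\Delta,\;C-A+\Delta)$. Then $\mathcal A_{R,S}$ satisfies $\big(\lambda,\max\{D^\lambda(P\|Q),D^\lambda(Q\|P)\}\big)$-RDP: for all $X_0,X_1\in\mathcal D^n$ that differ in exactly one record, $$D^\lambda(\mathcal A_{R,S}(X_0)\|\mathcal A_{R,S}(X_1))\le\max\{D^\lambda(P\|Q),D^\lambda(Q\|P)\}.$$ -/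

import Mathlib

open MeasureTheory ProbabilityTheory
open scoped ENNReal NNReal unitInterval

noncomputable section

namespace ShuffleRDP

/-- Rényi divergence of order `lam` of two probability measures,
`(lam - 1)⁻¹ * log E_{x ∼ ν} [(dμ/dν)(x) ^ lam]`, as an extended real number. As usual it is `⊤`
when `μ` is not absolutely continuous with respect to `ν`. -/
def renyiDiv {Ω : Type*} [MeasurableSpace Ω] (lam : ℝ) (μ ν : Measure Ω) : EReal :=
  open Classical in
  if μ ≪ ν then
    (((lam - 1)⁻¹ : ℝ) : EReal) * ENNReal.log (∫⁻ x, (μ.rnDeriv ν x) ^ lam ∂ν)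
  else ⊤

/-- Two data sets are neighbouring if they differ in exactly one record. -/
def Neighbouring {n : ℕ} {D : Type*} (X₀ X₁ : Fin n → D) : Prop :=
  ∃! i, X₀ i ≠ X₁ i

/-- A local randomizer, given by the law `M x` of its output on each input `x`, is `ε`-LDP. -/
def IsLDP {D Ω : Type*} [MeasurableSpace Ω] (ε : ℝ) (M : D → Measure Ω) : Prop :=
  ∀ x x' : D, ∀ E : Set Ω, MeasurableSet E → M x E ≤ ENNReal.ofReal (Real.exp ε) * M x' E

/-- A mechanism on data sets of size `n`, given by the law `M X` of its output on each data
set `X`, is `(lam, ε)`-RDP. -/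
def IsRDP {n : ℕ} {D Ω : Type*} [MeasurableSpace Ω] (lam : ℝ) (ε : EReal)
    (M : (Fin n → D) → Measure Ω) : Prop :=
  ∀ X₀ X₁ : Fin n → D, Neighbouring X₀ X₁ → renyiDiv lam (M X₀) (M X₁) ≤ ε

/-- The tuples `(z₁, …, z_k)` of the first `k` outputs. -/
abbrev Prefix {n : ℕ} (S : Fin n → Type*) (k : ℕ) (hk : k ≤ n) : Type _ :=
  (j : Fin k) → S (j.castLE hk)

/-- The law of the first `k` outputs when they are drawn one after the other, the output with
(zero-based) index `i` being drawn from `K i` given all the earlier outputs. -/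
def prefixLaw {n : ℕ} {S : Fin n → Type*} [∀ i, MeasurableSpace (S i)]
    (K : (i : Fin n) → Kernel (Prefix S i i.isLt.le) (S i)) :
    (k : ℕ) → (hk : k ≤ n) → Measure (Prefix S k hk)
  | 0, _ => Measure.dirac (fun j => j.elim0)
  | k + 1, hk =>
      ((prefixLaw K k (Nat.le_of_succ_le hk)) ⊗ₘ (K ⟨k, hk⟩)).map
        (fun w => Fin.snoc (α := fun j : Fin (k + 1) => S (j.castLE hk)) w.1 w.2)

/-- The law of all `n` outputs `(z₁, …, z_n)` drawn one after the other from `K`. -/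
def sequentialLaw {n : ℕ} {S : Fin n → Type*} [∀ i, MeasurableSpace (S i)]
    (K : (i : Fin n) → Kernel (Prefix S i i.isLt.le) (S i)) : Measure ((i : Fin n) → S i) :=
  prefixLaw K n le_rfl

/-- The adaptive process: the output law of `zᵢ = R i (z₁, …, zᵢ₋₁, xᵢ)`, `i = 1, …, n`. Here
`R i x` is the kernel sending the earlier outputs to the law of the `i`-th output on input `x`. -/
def adaptiveProcess {n : ℕ} {D : Type*} {S : Fin n → Type*} [∀ i, MeasurableSpace (S i)]
    (R : (i : Fin n) → D → Kernel (Prefix S i i.isLt.le) (S i)) (X : Fin n → D) :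
    Measure ((i : Fin n) → S i) :=
  sequentialLaw (fun i => R i (X i))

/-- The shuffled adaptive process: a permutation `π` is drawn uniformly, and the adaptive process
is run on the permuted data set, `zᵢ = R i (z₁, …, zᵢ₋₁, x_{π(i)})`. -/
def shuffledProcess {n : ℕ} {D : Type*} {S : Fin n → Type*} [∀ i, MeasurableSpace (S i)]
    (R : (i : Fin n) → D → Kernel (Prefix S i i.isLt.le) (S i)) (X : Fin n → D) :
    Measure ((i : Fin n) → S i) :=
  ∑ π : Equiv.Perm (Fin n), (n.factorial : ℝ≥0∞)⁻¹ • adaptiveProcess R (fun i => X (π i))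

/-- `p = e^{-ε₀}`. -/
def cloneProb (ε₀ : ℝ≥0) : I :=
  ⟨Real.exp (-ε₀), (Real.exp_pos _).le, Real.exp_le_one_iff.2 (neg_nonpos.2 ε₀.2)⟩

/-- `1 / (1 + p) = e^{ε₀} / (e^{ε₀} + 1)`, where `p = e^{-ε₀}`. -/
def flipProb (ε₀ : ℝ≥0) : I :=
  ⟨1 / (1 + Real.exp (-ε₀)), by positivity,
    (div_le_one (by positivity)).2 (le_add_of_nonneg_right (Real.exp_pos _).le)⟩

/-- The fair-coin parameter `1 / 2`. -/
def halfProb : I := ⟨1 / 2, by norm_num, by norm_num⟩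

/-- The joint law of `(C, A)`, where `C ∼ Bin(n - 1, p)` and, given `C`, `A ∼ Bin(C, 1/2)`. -/
def countLaw (n : ℕ) (ε₀ : ℝ≥0) : Measure (ℕ × ℕ) :=
  (binomial (n - 1) (cloneProb ε₀)).bind
    (fun c => (binomial c halfProb).map (fun a => (c, a)))

/-- The joint law of `((C, A), Δ)`, where `Δ ∼ Bern(1 / (1 + p))` is independent of `(C, A)`. -/
def countFlipLaw (n : ℕ) (ε₀ : ℝ≥0) : Measure ((ℕ × ℕ) × ℕ) :=
  (countLaw n ε₀).prod (bernoulliMeasure 1 0 (flipProb ε₀))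

/-- The law `P` of `(A + Δ, C - A + 1 - Δ)`. The subtractions never truncate, since `A ≤ C` and
`Δ ≤ 1` almost surely. -/
def lawP (n : ℕ) (ε₀ : ℝ≥0) : Measure (ℕ × ℕ) :=
  (countFlipLaw n ε₀).map
    (fun ω => (ω.1.2 + ω.2, ω.1.1 - ω.1.2 + 1 - ω.2))

/-- The law `Q` of `(A + 1 - Δ, C - A + Δ)`. -/
def lawQ (n : ℕ) (ε₀ : ℝ≥0) : Measure (ℕ × ℕ) :=
  (countFlipLaw n ε₀).map
    (fun ω => (ω.1.2 + 1 - ω.2, ω.1.1 - ω.1.2 + ω.2))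

end ShuffleRDP

end

/-!
Let `x₀`, `x₁` be the two values of the differing record and `p = e^{-ε₀}`. At every step and for
every history, the LDP condition makes the laws of the randomizer on `x₀` and on `x₁` mixtures of
two extremal laws, with the weights of `Δ` and of `1 - Δ`. It makes the law on any other record a
mixture which with probability `p` is the fair mixture of the two extremal laws (the record is then
a *clone* of one of two types) and otherwise a residual depending on the record. The weights do not
depend on the history, so the process may draw the types of all records beforehand. After averaging
over the order of the other records, the shuffled output depends on the types only through the
numbers of clones of each type, which have law `P` or `Q`. A single Markov kernel therefore sends
`P` and `Q` to the two output laws, and data processing concludes.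

Data processing itself is Hölder duality: `∫ (dμ/dν)^λ dν ≤ A` as soon as
`∫ g dμ ≤ A^(1/λ) (∫ g^λ' dν)^(1/λ')` for all `g ≥ 0`, and such bounds pass through kernels.
-/

namespace ShuffleRDP

/-! ### Data processing for the Rényi divergence -/

section DataProcessing

variable {α Ω : Type*} [MeasurableSpace α] [MeasurableSpace Ω] {p q : ℝ}

theorem lintegral_comp_le_mul_lintegral_comp_rpow (hpq : p.HolderConjugate q) {μ ν : Measure α}
    [SigmaFinite μ] [SigmaFinite ν] (hμν : μ ≪ ν) (κ : Kernel α Ω) [IsMarkovKernel κ]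
    {g : Ω → ℝ≥0∞} (hg : Measurable g) :
    ∫⁻ y, g y ∂(κ ∘ₘ μ) ≤
      (∫⁻ x, μ.rnDeriv ν x ^ p ∂ν) ^ (1 / p) * (∫⁻ y, g y ^ q ∂(κ ∘ₘ ν)) ^ (1 / q) := by
  calc ∫⁻ y, g y ∂(κ ∘ₘ μ)
      = ∫⁻ x, ∫⁻ y, g y ∂κ x ∂μ := Measure.lintegral_bind κ.aemeasurable hg.aemeasurable
    _ = ∫⁻ x, μ.rnDeriv ν x * ∫⁻ y, g y ∂κ x ∂ν :=
        (lintegral_rnDeriv_mul hμν hg.lintegral_kernel.aemeasurable).symm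
    _ = ∫⁻ z, μ.rnDeriv ν z.1 * g z.2 ∂(ν ⊗ₘ κ) := by
        rw [Measure.lintegral_compProd (by fun_prop)]
        simp_rw [lintegral_const_mul _ hg]
    _ ≤ (∫⁻ z, μ.rnDeriv ν z.1 ^ p ∂(ν ⊗ₘ κ)) ^ (1 / p) *
          (∫⁻ z, g z.2 ^ q ∂(ν ⊗ₘ κ)) ^ (1 / q) :=
        ENNReal.lintegral_mul_le_Lp_mul_Lq _ hpq (by fun_prop) (by fun_prop)
    _ = (∫⁻ x, μ.rnDeriv ν x ^ p ∂ν) ^ (1 / p) * (∫⁻ y, g y ^ q ∂(κ ∘ₘ ν)) ^ (1 / q) := by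
        congr 2
        · rw [Measure.lintegral_compProd (by fun_prop)]
          simp only [lintegral_const, measure_univ, mul_one]
        · rw [← Measure.snd_compProd, Measure.snd, lintegral_map (by fun_prop) measurable_snd]

theorem lintegral_min_rnDeriv_rpow_le (hpq : p.HolderConjugate q) {μ ν : Measure Ω}
    [IsFiniteMeasure ν] {A : ℝ≥0∞}
    (h : ∀ g : Ω → ℝ≥0∞, Measurable g →
      ∫⁻ y, g y ∂μ ≤ A ^ (1 / p) * (∫⁻ y, g y ^ q ∂ν) ^ (1 / q)) (m : ℕ) :
    ∫⁻ y, min (μ.rnDeriv ν y) m ^ p ∂ν ≤ A := by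
  set f : Ω → ℝ≥0∞ := fun y => min (μ.rnDeriv ν y) m
  have hf : Measurable f := (μ.measurable_rnDeriv ν).min measurable_const
  set J := ∫⁻ y, f y ^ p ∂ν with hJ
  have hJ_top : J ≠ ∞ := by
    refine ((lintegral_mono fun y => ENNReal.rpow_le_rpow (min_le_right _ (m : ℝ≥0∞))
      hpq.nonneg).trans_lt ?_).ne
    rw [lintegral_const]
    exact ENNReal.mul_lt_top (ENNReal.rpow_lt_top_of_nonneg hpq.nonneg (ENNReal.natCast_ne_top m))
      (measure_lt_top ν _)
  have hJ_le : J ≤ A ^ (1 / p) * J ^ (1 / q) :=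
    calc J = ∫⁻ y, f y * f y ^ (p - 1) ∂ν := by
          refine lintegral_congr fun y => ?_
          have := ENNReal.rpow_add_of_nonneg (x := f y) 1 (p - 1) zero_le_one hpq.sub_one_pos.le
          rw [add_sub_cancel, ENNReal.rpow_one] at this
          exact this
      _ ≤ ∫⁻ y, μ.rnDeriv ν y * f y ^ (p - 1) ∂ν :=
          lintegral_mono fun y => mul_le_mul_left (min_le_left _ _) _
      _ = ∫⁻ y, f y ^ (p - 1) ∂(ν.withDensity (μ.rnDeriv ν)) :=
          (lintegral_withDensity_eq_lintegral_mul _ (μ.measurable_rnDeriv ν) (by fun_prop)).symm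
      _ ≤ ∫⁻ y, f y ^ (p - 1) ∂μ := lintegral_mono' (Measure.withDensity_rnDeriv_le μ ν) le_rfl
      _ ≤ A ^ (1 / p) * J ^ (1 / q) := by
          refine (h _ (by fun_prop)).trans_eq ?_
          simp_rw [← ENNReal.rpow_mul, hpq.sub_one_mul_conj, hJ]
  obtain hJ_zero | hJ_zero := eq_or_ne J 0
  · exact hJ_zero.trans_le zero_le
  have hsplit : J ^ (1 / p) * J ^ (1 / q) = J := by
    rw [← ENNReal.rpow_add _ _ hJ_zero hJ_top, one_div, one_div, hpq.inv_add_inv_eq_one,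
      ENNReal.rpow_one]
  rw [← ENNReal.rpow_le_rpow_iff (one_div_pos.2 hpq.pos)]
  refine (ENNReal.mul_le_mul_iff_left ?_ ?_).1 (hsplit.trans_le hJ_le)
  · exact (ENNReal.rpow_pos (pos_iff_ne_zero.2 hJ_zero) hJ_top).ne'
  · exact ENNReal.rpow_ne_top_of_nonneg (one_div_nonneg.2 hpq.symm.nonneg) hJ_top

theorem lintegral_rnDeriv_rpow_le_of_forall_lintegral_le (hpq : p.HolderConjugate q)
    {μ ν : Measure Ω} [IsFiniteMeasure ν] {A : ℝ≥0∞}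
    (h : ∀ g : Ω → ℝ≥0∞, Measurable g →
      ∫⁻ y, g y ∂μ ≤ A ^ (1 / p) * (∫⁻ y, g y ^ q ∂ν) ^ (1 / q)) :
    ∫⁻ y, μ.rnDeriv ν y ^ p ∂ν ≤ A := by
  have hmeas : ∀ m : ℕ, Measurable fun y => min (μ.rnDeriv ν y) m ^ p := fun m =>
    ((μ.measurable_rnDeriv ν).min measurable_const).pow_const p
  refine le_of_tendsto' (lintegral_tendsto_of_tendsto_of_monotone
    (fun m => (hmeas m).aemeasurable) (.of_forall fun y m m' hm => ?_) (.of_forall fun y => ?_))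
    (lintegral_min_rnDeriv_rpow_le hpq h)
  · have := hpq.nonneg
    dsimp only
    gcongr
  · have hmin : Filter.Tendsto (fun m : ℕ => min (μ.rnDeriv ν y) m) Filter.atTop
        (nhds (μ.rnDeriv ν y)) := by
      simpa using tendsto_const_nhds.min ENNReal.tendsto_nat_nhds_top
    exact (ENNReal.continuous_rpow_const.tendsto _).comp hmin

theorem renyiDiv_comp_le {lam : ℝ} (hlam : 1 < lam) (μ ν : Measure α) [SigmaFinite μ]
    [IsFiniteMeasure ν] (κ : Kernel α Ω) [IsMarkovKernel κ] :
    renyiDiv lam (κ ∘ₘ μ) (κ ∘ₘ ν) ≤ renyiDiv lam μ ν := by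
  by_cases hμν : μ ≪ ν
  · rw [renyiDiv, renyiDiv, if_pos hμν, if_pos (hμν.comp_right κ)]
    have hcoef : (0 : EReal) ≤ ((lam - 1)⁻¹ : ℝ) :=
      EReal.coe_nonneg.2 (inv_nonneg.2 (sub_nonneg.2 hlam.le))
    refine mul_le_mul_of_nonneg_left (ENNReal.log_monotone ?_) hcoef
    have hconj := Real.HolderConjugate.conjExponent hlam
    exact lintegral_rnDeriv_rpow_le_of_forall_lintegral_le hconj fun g hg =>
      lintegral_comp_le_mul_lintegral_comp_rpow hconj hμν κ hg
  · rw [renyiDiv, renyiDiv, if_neg hμν]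
    exact le_top

end DataProcessing

/-! ### Mixtures of sequential and shuffled processes -/

section Sequential

theorem sum_smul_compProd {α β ι : Type*} [MeasurableSpace α] [MeasurableSpace β] [Fintype ι]
    (v : ι → ℝ≥0∞) (μ : ι → Measure α) [∀ i, SFinite (μ i)] (κ : Kernel α β)
    [IsSFiniteKernel κ] : (∑ i, v i • μ i) ⊗ₘ κ = ∑ i, v i • (μ i ⊗ₘ κ) := by
  simp only [← Measure.sum_fintype, Measure.compProd_sum_left, Measure.compProd_smul_left]

theorem compProd_eq_sum_smul {α β T : Type*} [MeasurableSpace α] [MeasurableSpace β] [Fintype T]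
    (μ : Measure α) [SFinite μ] (w : T → ℝ≥0∞) (κ : T → Kernel α β) [∀ t, IsSFiniteKernel (κ t)]
    {K : Kernel α β} [IsSFiniteKernel K] (hK : ∀ a, K a = ∑ t, w t • κ t a) :
    μ ⊗ₘ K = ∑ t, w t • (μ ⊗ₘ κ t) := by
  ext E hE
  have hmeas : ∀ t, Measurable fun a => κ t a (Prod.mk a ⁻¹' E) :=
    fun t => Kernel.measurable_kernel_prodMk_left hE
  simp only [Measure.compProd_apply hE, hK, Measure.finsetSum_apply, Measure.smul_apply,
    smul_eq_mul, lintegral_finsetSum _ fun t _ => (hmeas t).const_mul (w t),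
    lintegral_const_mul _ (hmeas _)]

variable {n : ℕ} {S : Fin n → Type*} [∀ i, MeasurableSpace (S i)]

theorem measurable_prefix_snoc {k : ℕ} (hk : k + 1 ≤ n) :
    Measurable (fun w : Prefix S k (Nat.le_of_succ_le hk) × S ⟨k, hk⟩ =>
      (Fin.snoc (α := fun j : Fin (k + 1) => S (j.castLE hk)) w.1 w.2 : Prefix S (k + 1) hk)) := by
  refine measurable_pi_lambda _ fun j => ?_
  refine Fin.lastCases ?_ (fun j => ?_) j
  · simp only [Fin.snoc_last]
    exact measurable_snd
  · simp only [Fin.snoc_castSucc]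
    exact (measurable_pi_apply j).comp measurable_fst

instance isProbabilityMeasure_prefixLaw
    (K : (i : Fin n) → Kernel (Prefix S i i.isLt.le) (S i)) [∀ i, IsMarkovKernel (K i)] :
    ∀ (k : ℕ) (hk : k ≤ n), IsProbabilityMeasure (prefixLaw K k hk)
  | 0, _ => by unfold prefixLaw; infer_instance
  | k + 1, hk => by
      have := isProbabilityMeasure_prefixLaw K k (Nat.le_of_succ_le hk)
      unfold prefixLaw
      exact Measure.isProbabilityMeasure_map (measurable_prefix_snoc hk).aemeasurable

instance isProbabilityMeasure_sequentialLaw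
    (K : (i : Fin n) → Kernel (Prefix S i i.isLt.le) (S i)) [∀ i, IsMarkovKernel (K i)] :
    IsProbabilityMeasure (sequentialLaw K) :=
  isProbabilityMeasure_prefixLaw K n le_rfl

variable {T : Type*} [Fintype T] {K : (i : Fin n) → Kernel (Prefix S i i.isLt.le) (S i)}
  [∀ i, IsMarkovKernel (K i)] {w : Fin n → T → ℝ≥0∞}
  {G : (i : Fin n) → T → Kernel (Prefix S i i.isLt.le) (S i)} [∀ i t, IsMarkovKernel (G i t)]

/- Only the first `k` kernels enter `prefixLaw · k hk`, so a word of length `k` may be extended to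
one of length `n` by any choice `e` of further letters. -/
theorem prefixLaw_eq_sum_smul (hK : ∀ i z, K i z = ∑ t, w i t • G i t z) (k : ℕ) (hk : k ≤ n)
    (e : (Fin k → T) → Fin n → T) (he : ∀ τ j, e τ (j.castLE hk) = τ j) :
    prefixLaw K k hk =
      ∑ τ, (∏ j, w (j.castLE hk) (τ j)) • prefixLaw (fun i => G i (e τ i)) k hk := by
  induction k with
  | zero => simp [prefixLaw]
  | succ k ih =>
    have hk' : k ≤ n := Nat.le_of_succ_le hk
    have hlast : ∀ t τ, e (Fin.snoc τ t) ⟨k, hk⟩ = t := fun t τ =>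
      (he (Fin.snoc τ t) (Fin.last k)).trans (Fin.snoc_last _ _)
    have hinit : ∀ t (τ : Fin k → T) j, e (Fin.snoc τ t) (j.castLE hk') = τ j := fun t τ j =>
      (he (Fin.snoc τ t) j.castSucc).trans (Fin.snoc_castSucc _ _ _)
    calc prefixLaw K (k + 1) hk
        = ∑ t, ∑ τ : Fin k → T, (w ⟨k, hk⟩ t * ∏ j, w (j.castLE hk') (τ j)) •
            prefixLaw (fun i => G i (e (Fin.snoc τ t) i)) (k + 1) hk := by
          rw [prefixLaw, compProd_eq_sum_smul _ _ _ (hK ⟨k, hk⟩),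
            Measure.map_finset_sum (measurable_prefix_snoc hk).aemeasurable]
          refine Finset.sum_congr rfl fun t _ => ?_
          rw [ih hk' (fun τ => e (Fin.snoc τ t)) (hinit t), sum_smul_compProd, Measure.map_smul,
            Measure.map_finset_sum (measurable_prefix_snoc hk).aemeasurable, Finset.smul_sum]
          refine Finset.sum_congr rfl fun τ _ => ?_
          rw [Measure.map_smul, smul_smul, prefixLaw, hlast]
      _ = ∑ τ, (∏ j, w (j.castLE hk) (τ j)) • prefixLaw (fun i => G i (e τ i)) (k + 1) hk := by
          rw [← (Fin.snocEquiv fun _ => T).sum_comp, Fintype.sum_prod_type]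
          refine Finset.sum_congr rfl fun t _ => Finset.sum_congr rfl fun τ _ => ?_
          simp only [Fin.snocEquiv_apply, Fin.prod_univ_castSucc, Fin.snoc_castSucc, Fin.snoc_last]
          rw [mul_comm]
          rfl

theorem sequentialLaw_eq_sum_smul (hK : ∀ i z, K i z = ∑ t, w i t • G i t z) :
    sequentialLaw K = ∑ τ : Fin n → T, (∏ j, w j (τ j)) • sequentialLaw fun i => G i (τ i) :=
  prefixLaw_eq_sum_smul hK n le_rfl id fun _ _ => rfl

end Sequential

section Shuffle

variable {n : ℕ} {D D' : Type*} {S : Fin n → Type*} [∀ i, MeasurableSpace (S i)]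
  (R : (i : Fin n) → D → Kernel (Prefix S i i.isLt.le) (S i))

theorem shuffledProcess_comp_perm (X : Fin n → D) (φ : Equiv.Perm (Fin n)) :
    shuffledProcess R (X ∘ φ) = shuffledProcess R X :=
  Equiv.sum_comp (Equiv.mulLeft φ) fun π =>
    (n.factorial : ℝ≥0∞)⁻¹ • adaptiveProcess R fun i => X (π i)

theorem sum_perm_inv_factorial (n : ℕ) :
    ∑ _π : Equiv.Perm (Fin n), (n.factorial : ℝ≥0∞)⁻¹ = 1 := by
  simp [Fintype.card_perm, ENNReal.mul_inv_cancel, Nat.factorial_ne_zero]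

theorem isProbabilityMeasure_sum_inv_factorial_smul {Ω : Type*} [MeasurableSpace Ω]
    (μ : Equiv.Perm (Fin n) → Measure Ω) [∀ π, IsProbabilityMeasure (μ π)] :
    IsProbabilityMeasure (∑ π, (n.factorial : ℝ≥0∞)⁻¹ • μ π) :=
  ⟨by simp only [Measure.finsetSum_apply, Measure.smul_apply, measure_univ, smul_eq_mul, mul_one,
    sum_perm_inv_factorial]⟩

instance isProbabilityMeasure_shuffledProcess [∀ i x, IsMarkovKernel (R i x)] (X : Fin n → D) :
    IsProbabilityMeasure (shuffledProcess R X) :=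
  isProbabilityMeasure_sum_inv_factorial_smul fun π => sequentialLaw fun i => R i (X (π i))

variable {R}

theorem shuffledProcess_eq_sum_smul {T : Type*} [Fintype T] [∀ i x, IsMarkovKernel (R i x)]
    {R' : (i : Fin n) → D' → Kernel (Prefix S i i.isLt.le) (S i)} [∀ i y, IsMarkovKernel (R' i y)]
    {X : Fin n → D} {Y : Fin n → T → D'} {w : Fin n → T → ℝ≥0∞}
    (h : ∀ i j z, R i (X j) z = ∑ t, w j t • R' i (Y j t) z) :
    shuffledProcess R X =
      ∑ τ : Fin n → T, (∏ j, w j (τ j)) • shuffledProcess R' fun j => Y j (τ j) := by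
  simp only [shuffledProcess, Finset.smul_sum]
  rw [Finset.sum_comm]
  refine Finset.sum_congr rfl fun π _ => ?_
  rw [adaptiveProcess, sequentialLaw_eq_sum_smul fun i z => h i (π i) z, Finset.smul_sum,
    ← (Equiv.arrowCongr π.symm (Equiv.refl T)).sum_comp]
  refine Finset.sum_congr rfl fun τ _ => ?_
  rw [smul_comm]
  congr 1
  exact Equiv.prod_comp π fun j => w j (τ j)

end Shuffle

/-! ### Words of clones -/

section Words

theorem exists_perm_comp_eq {ι T : Type*} [Fintype ι] [DecidableEq T] {f g : ι → T}
    (h : ∀ t, Fintype.card {i // f i = t} = Fintype.card {i // g i = t}) :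
    ∃ φ : Equiv.Perm ι, g ∘ φ = f :=
  ⟨Equiv.ofFiberEquiv fun t => Fintype.equivOfCardEq (h t), funext (Equiv.ofFiberEquiv_map _)⟩

/-- The numbers of clones of the two types in a word: the letter `some b` marks a clone of type
`b`, the letter `none` a record that is not a clone. -/
def cloneCounts {ι : Type*} [Fintype ι] (w : ι → Option Bool) : ℕ × ℕ :=
  (Fintype.card {i // w i = some true}, Fintype.card {i // w i = some false})

theorem exists_perm_comp_eq_of_cloneCounts_eq {ι : Type*} [Fintype ι] {w w' : ι → Option Bool}
    (h : cloneCounts w = cloneCounts w') : ∃ φ : Equiv.Perm ι, w' ∘ φ = w := by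
  have htotal : ∀ w : ι → Option Bool, Fintype.card {i // w i = none} +
      (cloneCounts w).1 + (cloneCounts w).2 = Fintype.card ι := fun w => by
    rw [← Fintype.card_congr (Equiv.sigmaFiberEquiv w), Fintype.card_sigma, Fintype.sum_option,
      Fintype.sum_bool, ← add_assoc]
    rfl
  refine exists_perm_comp_eq fun t => ?_
  match t with
  | none =>
    have hw := htotal w
    have hw' := htotal w'
    rw [h] at hw
    omega
  | some true => exact congrArg Prod.fst h
  | some false => exact congrArg Prod.snd h

theorem cloneCounts_cons {m : ℕ} (t : Option Bool) (w : Fin m → Option Bool) :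
    cloneCounts (Fin.cons t w : Fin (m + 1) → Option Bool) =
      t.elim 0 (fun b => bif b then (1, 0) else (0, 1)) + cloneCounts w := by
  simp only [cloneCounts, Fintype.card_subtype, Fin.card_filter_univ_succ', Fin.cons_zero]
  rcases t with _ | _ | _ <;> simp

variable {m : ℕ} {D : Type*}

/-- The data set `X` with every record marked as a clone by the word `w` replaced by its type. -/
def mask {ι : Type*} (w : ι → Option Bool) (X : ι → D) (i : ι) : Bool ⊕ D :=
  (w i).elim (Sum.inr (X i)) Sum.inl

theorem cons_comp_decomposeFin_symm_zero {α : Type*} (x : α) (Y : Fin m → α)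
    (θ : Equiv.Perm (Fin m)) :
    (Fin.cons x Y : Fin (m + 1) → α) ∘ Equiv.Perm.decomposeFin.symm (0, θ) =
      Fin.cons x (Y ∘ θ) := by
  ext j
  cases j using Fin.cases <;> simp

/- If neither record `0` nor record `φ 0` is kept, then `φ` carries the kept records of `Y ∘ ρ` to
those of `Y`, whatever its value at `0`. -/
theorem mask_comp_perm {w : Fin (m + 1) → Option Bool} (h₀ : w 0 ≠ none)
    (p : Fin (m + 1)) (ρ : Equiv.Perm (Fin m)) (hp : w p ≠ none) (x : D) (Y : Fin m → D) :
    mask (w ∘ Equiv.Perm.decomposeFin.symm (p, ρ)) (Fin.cons x (Y ∘ ρ)) =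
      mask w (Fin.cons x Y) ∘ Equiv.Perm.decomposeFin.symm (p, ρ) := by
  ext1 k
  simp only [mask, Function.comp_apply]
  cases hk : w (Equiv.Perm.decomposeFin.symm (p, ρ) k) with
  | some b => rfl
  | none =>
    cases k using Fin.cases with
    | zero => exact absurd hk (by simpa using hp)
    | succ j =>
      rw [Equiv.Perm.decomposeFin_symm_apply_succ] at hk ⊢
      have hj : (ρ j).succ ≠ p := by
        rintro rfl
        rw [Equiv.swap_apply_right] at hk
        exact h₀ hk
      simp [Equiv.swap_apply_of_ne_of_ne (Fin.succ_ne_zero _) hj]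

end Words

section Masked

variable {m : ℕ} {D : Type*} {S : Fin (m + 1) → Type*} [∀ i, MeasurableSpace (S i)]

/-- The output law of the shuffled process when the records marked by the word `w` are clones,
averaged over the order of the records `Y`. The record `x` only matters if `w 0 = none`. -/
noncomputable def maskedLaw
    (R : (i : Fin (m + 1)) → Bool ⊕ D → Kernel (Prefix S i i.isLt.le) (S i)) (x : D)
    (Y : Fin m → D) (w : Fin (m + 1) → Option Bool) : Measure ((i : Fin (m + 1)) → S i) :=
  ∑ θ : Equiv.Perm (Fin m),
    (m.factorial : ℝ≥0∞)⁻¹ • shuffledProcess R (mask w (Fin.cons x (Y ∘ θ)))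

instance isProbabilityMeasure_maskedLaw
    (R : (i : Fin (m + 1)) → Bool ⊕ D → Kernel (Prefix S i i.isLt.le) (S i))
    [∀ i y, IsMarkovKernel (R i y)] (x : D) (Y : Fin m → D) (w : Fin (m + 1) → Option Bool) :
    IsProbabilityMeasure (maskedLaw R x Y w) :=
  isProbabilityMeasure_sum_inv_factorial_smul _

theorem maskedLaw_eq_of_cloneCounts_eq
    (R : (i : Fin (m + 1)) → Bool ⊕ D → Kernel (Prefix S i i.isLt.le) (S i)) (x : D)
    (Y : Fin m → D) {w w' : Fin (m + 1) → Option Bool} (h₀ : w 0 ≠ none) (h₀' : w' 0 ≠ none)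
    (h : cloneCounts w = cloneCounts w') : maskedLaw R x Y w = maskedLaw R x Y w' := by
  obtain ⟨φ, rfl⟩ := exists_perm_comp_eq_of_cloneCounts_eq h
  obtain ⟨⟨p, ρ⟩, rfl⟩ := Equiv.Perm.decomposeFin.symm.surjective φ
  have hp : w' p ≠ none := by simpa using h₀
  rw [maskedLaw, maskedLaw, ← Equiv.sum_comp (Equiv.mulRight ρ)]
  refine Finset.sum_congr rfl fun θ _ => ?_
  congr 1
  exact (congrArg (shuffledProcess R) (mask_comp_perm h₀' p ρ hp x (Y ∘ θ))).trans
    (shuffledProcess_comp_perm R _ _)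

theorem shuffledProcess_cons_eq_sum_maskedLaw
    {R : (i : Fin (m + 1)) → D → Kernel (Prefix S i i.isLt.le) (S i)}
    [∀ i x, IsMarkovKernel (R i x)]
    {R' : (i : Fin (m + 1)) → Bool ⊕ D → Kernel (Prefix S i i.isLt.le) (S i)}
    [∀ i y, IsMarkovKernel (R' i y)] {x y : D} {Y : Fin m → D} {u v : Option Bool → ℝ≥0∞}
    (hu : ∀ i z, R i y z = ∑ t, u t • R' i (t.elim (Sum.inr x) Sum.inl) z)
    (hv : ∀ i a z, R i a z = ∑ t, v t • R' i (t.elim (Sum.inr a) Sum.inl) z) :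
    shuffledProcess R (Fin.cons y Y) = ∑ w : Fin (m + 1) → Option Bool,
      (u (w 0) * ∏ j : Fin m, v (w j.succ)) • maskedLaw R' x Y w := by
  have horder : ∀ θ : Equiv.Perm (Fin m), shuffledProcess R (Fin.cons y Y) =
      ∑ w : Fin (m + 1) → Option Bool, (u (w 0) * ∏ j : Fin m, v (w j.succ)) •
        shuffledProcess R' (mask w (Fin.cons x (Y ∘ θ))) := fun θ => by
    have hmix : ∀ i j z, R i ((Fin.cons y (Y ∘ θ) : Fin (m + 1) → D) j) z =
        ∑ t, (Fin.cons u (fun _ => v) : Fin (m + 1) → Option Bool → ℝ≥0∞) j t •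
          R' i (t.elim (Sum.inr ((Fin.cons x (Y ∘ θ) : Fin (m + 1) → D) j)) Sum.inl) z :=
      fun i j z => by cases j using Fin.cases with
        | zero => exact hu i z
        | succ j => exact hv i _ z
    rw [← shuffledProcess_comp_perm R _ (Equiv.Perm.decomposeFin.symm (0, θ)),
      cons_comp_decomposeFin_symm_zero, shuffledProcess_eq_sum_smul hmix]
    simp only [Fin.prod_univ_succ, Fin.cons_zero, Fin.cons_succ]
    rfl
  rw [← one_smul ℝ≥0∞ (shuffledProcess R (Fin.cons y Y)), ← sum_perm_inv_factorial m,
    Finset.sum_smul]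
  simp only [maskedLaw, Finset.smul_sum]
  rw [Finset.sum_comm]
  refine Finset.sum_congr rfl fun θ _ => ?_
  rw [horder θ, Finset.smul_sum]
  exact Finset.sum_congr rfl fun w _ => smul_comm _ _ _

end Masked

/-! ### The laws of the clone counts -/

section Counts

/-- The probability that a coin with success probability `p` shows `b`. -/
noncomputable def coinWeight (p : I) (b : Bool) : ℝ≥0∞ :=
  ENNReal.ofReal (bif b then p else 1 - p)

theorem toReal_coinWeight_true (p : I) : (coinWeight p true).toReal = p :=
  ENNReal.toReal_ofReal p.2.1

theorem toReal_coinWeight_false (p : I) : (coinWeight p false).toReal = 1 - p :=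
  ENNReal.toReal_ofReal (sub_nonneg.2 p.2.2)

theorem coinWeight_ne_top (p : I) (b : Bool) : coinWeight p b ≠ ∞ :=
  ENNReal.ofReal_ne_top

theorem coinWeight_add (p : I) : coinWeight p true + coinWeight p false = 1 := by
  simp only [coinWeight, cond_true, cond_false]
  rw [← ENNReal.ofReal_add p.2.1 (sub_nonneg.2 p.2.2), add_sub_cancel, ENNReal.ofReal_one]

theorem sum_coinWeight (p : I) : ∑ b, coinWeight p b = 1 := by
  rw [Fintype.sum_bool, coinWeight_add]

theorem coinWeight_symm (p : I) (b : Bool) :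
    coinWeight (unitInterval.symm p) b = coinWeight p (!b) := by
  cases b <;> simp [coinWeight]

/-- The weight of a letter: a record is a clone with probability `p`, and a clone has type `b`
with probability `coinWeight r b`. -/
noncomputable def letterWeight (p r : I) : Option Bool → ℝ≥0∞
  | none => coinWeight p false
  | some b => coinWeight p true * coinWeight r b

theorem letterWeight_one_none (r : I) : letterWeight 1 r none = 0 := by
  simp [letterWeight, coinWeight]

theorem letterWeight_one_some (r : I) (b : Bool) : letterWeight 1 r (some b) = coinWeight r b := by
  simp [letterWeight, coinWeight]

theorem lintegral_binomial (m : ℕ) (p : I) (f : ℕ → ℕ → ℝ≥0∞) :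
    ∫⁻ k, f k (m - k) ∂(binomial m p) = ∑ ij ∈ Finset.HasAntidiagonal.antidiagonal m,
      m.choose ij.1 • (coinWeight p true ^ ij.1 * coinWeight p false ^ ij.2 * f ij.1 ij.2) := by
  rw [binomial_eq_sum_dirac, lintegral_finsetSum_measure,
    Finset.Nat.sum_antidiagonal_eq_sum_range_succ_mk, Nat.range_succ_eq_Iic]
  refine Finset.sum_congr rfl fun k _ => ?_
  have hp : (0 : ℝ) ≤ p := p.2.1
  have hq : (0 : ℝ) ≤ 1 - p := sub_nonneg.2 p.2.2
  rw [lintegral_smul_measure, lintegral_dirac, smul_eq_mul, nsmul_eq_mul,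
    ENNReal.ofReal_mul (by positivity), ENNReal.ofReal_mul (by positivity),
    ENNReal.ofReal_pow hp, ENNReal.ofReal_pow hq, ENNReal.ofReal_natCast]
  simp only [coinWeight, cond_true, cond_false]
  ring

theorem lintegral_binomial_succ (m : ℕ) (p : I) (f : ℕ → ℕ → ℝ≥0∞) :
    ∫⁻ k, f k (m + 1 - k) ∂(binomial (m + 1) p) =
      coinWeight p true * ∫⁻ k, f (k + 1) (m - k) ∂(binomial m p) +
        coinWeight p false * ∫⁻ k, f k (m - k + 1) ∂(binomial m p) := by
  rw [lintegral_binomial, Finset.sum_antidiagonal_choose_succ_nsmul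
    (fun i j => coinWeight p true ^ i * coinWeight p false ^ j * f i j), add_comm,
    lintegral_binomial m p fun i j => f (i + 1) j, lintegral_binomial m p fun i j => f i (j + 1),
    Finset.mul_sum, Finset.mul_sum]
  congr 1 <;> refine Finset.sum_congr rfl fun ij hij => ?_
  · rw [← Finset.HasAntidiagonal.mem_antidiagonal.1 hij, Nat.choose_symm_add]
    simp only [nsmul_eq_mul]
    ring
  · simp only [nsmul_eq_mul]
    ring

theorem sum_fin_succ_pi {m : ℕ} {T M : Type*} [Fintype T] [AddCommMonoid M]
    (f : (Fin (m + 1) → T) → M) : ∑ w, f w = ∑ t, ∑ w : Fin m → T, f (Fin.cons t w) := by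
  rw [← (Fin.consEquiv fun _ => T).sum_comp, Fintype.sum_prod_type]
  rfl

theorem mk_one_zero_add (x : ℕ × ℕ) : (1, 0) + x = (x.1 + 1, x.2) :=
  Prod.ext (add_comm _ _) (zero_add _)

theorem mk_zero_one_add (x : ℕ × ℕ) : (0, 1) + x = (x.1, x.2 + 1) :=
  Prod.ext (zero_add _) (add_comm _ _)

theorem lintegral_binomial_binomial (m : ℕ) (p r : I) (F : ℕ × ℕ → ℝ≥0∞) :
    ∫⁻ c, ∫⁻ a, F (a, c - a) ∂(binomial c r) ∂(binomial m p) =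
      ∑ w : Fin m → Option Bool, (∏ j, letterWeight p r (w j)) * F (cloneCounts w) := by
  induction m generalizing F with
  | zero => simp [binomial_zero, cloneCounts]
  | succ m ih =>
    rw [lintegral_binomial_succ m p fun c _ => ∫⁻ a, F (a, c - a) ∂(binomial c r)]
    simp_rw [lintegral_binomial_succ _ r fun a b => F (a, b)]
    rw [lintegral_add_left Measurable.of_discrete, lintegral_const_mul _ Measurable.of_discrete,
      lintegral_const_mul _ Measurable.of_discrete, ih, ih fun x => F (x.1 + 1, x.2),
      ih fun x => F (x.1, x.2 + 1), sum_fin_succ_pi, Fintype.sum_option, Fintype.sum_bool]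
    simp only [Fin.prod_univ_succ, Fin.cons_zero, Fin.cons_succ, cloneCounts_cons, Option.elim,
      cond_true, cond_false, mul_assoc, ← Finset.mul_sum, zero_add]
    simp only [mk_one_zero_add, mk_zero_one_add, letterWeight]
    ring

theorem lintegral_countLaw (n : ℕ) (ε₀ : ℝ≥0) (G : ℕ × ℕ → ℝ≥0∞) :
    ∫⁻ x, G x ∂(countLaw n ε₀) =
      ∫⁻ c, ∫⁻ a, G (c, a) ∂(binomial c halfProb) ∂(binomial (n - 1) (cloneProb ε₀)) := by
  rw [countLaw, Measure.lintegral_bind Measurable.of_discrete.aemeasurable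
    Measurable.of_discrete.aemeasurable]
  simp_rw [lintegral_map (Measurable.of_discrete (f := G)) Measurable.of_discrete]

theorem lintegral_bernoulliMeasure (p : I) (f : ℕ → ℝ≥0∞) :
    ∫⁻ d, f d ∂(bernoulliMeasure 1 0 p) = coinWeight p true * f 1 + coinWeight p false * f 0 := by
  rw [bernoulliMeasure_def, lintegral_add_measure, lintegral_smul_measure, lintegral_smul_measure,
    lintegral_dirac, lintegral_dirac, coinWeight, coinWeight, cond_true, cond_false,
    ENNReal.ofReal_eq_coe_nnreal p.2.1, ENNReal.ofReal_eq_coe_nnreal (sub_nonneg.2 p.2.2)]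
  rfl

theorem lintegral_countFlipLaw (n : ℕ) (ε₀ : ℝ≥0) (G : (ℕ × ℕ) × ℕ → ℝ≥0∞) :
    ∫⁻ x, G x ∂(countFlipLaw n ε₀) =
      coinWeight (flipProb ε₀) true * ∫⁻ x, G (x, 1) ∂(countLaw n ε₀) +
        coinWeight (flipProb ε₀) false * ∫⁻ x, G (x, 0) ∂(countLaw n ε₀) := by
  rw [countFlipLaw, lintegral_prod _ Measurable.of_discrete.aemeasurable]
  simp_rw [lintegral_bernoulliMeasure]
  rw [lintegral_add_left Measurable.of_discrete, lintegral_const_mul _ Measurable.of_discrete,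
    lintegral_const_mul _ Measurable.of_discrete]

/-- The weight of a word when the letters after the first are those of independent records, and
the first letter is a clone of type `b` with probability `coinWeight p b`. -/
noncomputable def wordWeight {m : ℕ} (ε₀ : ℝ≥0) (p : I) (w : Fin (m + 1) → Option Bool) : ℝ≥0∞ :=
  letterWeight 1 p (w 0) * ∏ j : Fin m, letterWeight (cloneProb ε₀) halfProb (w j.succ)

theorem sum_wordWeight_mul (m : ℕ) (ε₀ : ℝ≥0) (p : I) (F : ℕ × ℕ → ℝ≥0∞) :
    ∑ w : Fin (m + 1) → Option Bool, wordWeight ε₀ p w * F (cloneCounts w) =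
      coinWeight p true * ∫⁻ x, F (x.2 + 1, x.1 - x.2) ∂(countLaw (m + 1) ε₀) +
        coinWeight p false * ∫⁻ x, F (x.2, x.1 - x.2 + 1) ∂(countLaw (m + 1) ε₀) := by
  rw [lintegral_countLaw, lintegral_countLaw, Nat.add_sub_cancel,
    lintegral_binomial_binomial m _ _ fun x => F (x.1 + 1, x.2),
    lintegral_binomial_binomial m _ _ fun x => F (x.1, x.2 + 1),
    sum_fin_succ_pi, Fintype.sum_option, Fintype.sum_bool]
  simp only [wordWeight, Fin.cons_zero, Fin.cons_succ, letterWeight_one_none,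
    letterWeight_one_some, cloneCounts_cons, Option.elim, cond_true, cond_false, mk_one_zero_add,
    mk_zero_one_add, zero_mul, Finset.sum_const_zero, zero_add, mul_assoc, ← Finset.mul_sum]

theorem lawP_succ (m : ℕ) (ε₀ : ℝ≥0) : lawP (m + 1) ε₀ =
    ∑ w : Fin (m + 1) → Option Bool,
      wordWeight ε₀ (flipProb ε₀) w • Measure.dirac (cloneCounts w) := by
  refine Measure.ext_of_lintegral _ fun F hF => ?_
  rw [lawP, lintegral_map hF Measurable.of_discrete, lintegral_countFlipLaw,
    lintegral_finsetSum_measure]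
  simp only [lintegral_smul_measure, lintegral_dirac, smul_eq_mul, sum_wordWeight_mul,
    Nat.add_sub_cancel, add_zero, Nat.sub_zero]

theorem lawQ_succ (m : ℕ) (ε₀ : ℝ≥0) : lawQ (m + 1) ε₀ =
    ∑ w : Fin (m + 1) → Option Bool,
      wordWeight ε₀ (unitInterval.symm (flipProb ε₀)) w • Measure.dirac (cloneCounts w) := by
  refine Measure.ext_of_lintegral _ fun F hF => ?_
  rw [lawQ, lintegral_map hF Measurable.of_discrete, lintegral_countFlipLaw,
    lintegral_finsetSum_measure]
  simp only [lintegral_smul_measure, lintegral_dirac, smul_eq_mul, sum_wordWeight_mul,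
    coinWeight_symm, Bool.not_true, Bool.not_false, Nat.add_sub_cancel, add_zero, Nat.sub_zero]
  exact add_comm _ _

instance isProbabilityMeasure_countLaw (n : ℕ) (ε₀ : ℝ≥0) :
    IsProbabilityMeasure (countLaw n ε₀) :=
  isProbabilityMeasure_bind Measurable.of_discrete.aemeasurable <| .of_forall fun _ =>
    Measure.isProbabilityMeasure_map Measurable.of_discrete.aemeasurable

instance isProbabilityMeasure_countFlipLaw (n : ℕ) (ε₀ : ℝ≥0) :
    IsProbabilityMeasure (countFlipLaw n ε₀) := by
  unfold countFlipLaw; infer_instance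

instance isProbabilityMeasure_lawP (n : ℕ) (ε₀ : ℝ≥0) : IsProbabilityMeasure (lawP n ε₀) :=
  Measure.isProbabilityMeasure_map Measurable.of_discrete.aemeasurable

instance isProbabilityMeasure_lawQ (n : ℕ) (ε₀ : ℝ≥0) : IsProbabilityMeasure (lawQ n ε₀) :=
  Measure.isProbabilityMeasure_map Measurable.of_discrete.aemeasurable

end Counts

/-! ### Clone decomposition of LDP randomizers -/

section CloneDecomposition

variable {α β : Type*} [MeasurableSpace α] [MeasurableSpace β]

theorem exists_kernel_eq_sum_smul {T : Type*} [Fintype T] {w : T → ℝ≥0∞} (hw : ∑ t, w t = 1)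
    (η : T → Kernel α β) [∀ t, IsMarkovKernel (η t)] :
    ∃ κ : Kernel α β, IsMarkovKernel κ ∧ ∀ a, κ a = ∑ t, w t • η t a := by
  refine ⟨⟨fun a => ∑ t, w t • η t a, Measure.measurable_of_measurable_coe _ fun E hE => ?_⟩,
    ⟨fun a => ⟨?_⟩⟩, fun a => rfl⟩
  · simp only [Measure.finsetSum_apply, Measure.smul_apply, smul_eq_mul]
    exact Finset.measurable_fun_sum _ fun t _ => ((η t).measurable_coe hE).const_mul _
  · simp [hw]

theorem exists_residual_kernel {κ η : Kernel α β} [IsMarkovKernel κ] [IsMarkovKernel η] {p : I}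
    (h : ∀ a, coinWeight p true • η a ≤ κ a) :
    ∃ ρ : Kernel α β, IsMarkovKernel ρ ∧
      ∀ a, κ a = coinWeight p true • η a + coinWeight p false • ρ a := by
  obtain hq | hq := eq_or_ne (coinWeight p false) 0
  · have hp : coinWeight p true = 1 := by simpa [hq] using coinWeight_add p
    refine ⟨η, inferInstance, fun a => ?_⟩
    rw [hq, hp, one_smul, zero_smul, add_zero]
    exact (Measure.eq_of_le_of_isProbabilityMeasure (by simpa [hp] using h a)).symm
  have hfin : ∀ a, IsFiniteMeasure (coinWeight p true • η a) := fun a =>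
    (η a).smul_finite (coinWeight_ne_top p true)
  have hdiff : ∀ a E, MeasurableSet E → (κ a - coinWeight p true • η a) E =
      κ a E - coinWeight p true * η a E := fun a E hE => by
    rw [Measure.sub_apply hE (h a), Measure.smul_apply, smul_eq_mul]
  let ρ : Kernel α β :=
    ⟨fun a => (coinWeight p false)⁻¹ • (κ a - coinWeight p true • η a),
      Measure.measurable_of_measurable_coe _ fun E hE => by
        simp only [Measure.smul_apply, hdiff _ E hE]
        have hη := (η.measurable_coe hE).const_mul (coinWeight p true)
        exact ((κ.measurable_coe hE).sub hη).const_mul _⟩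
  have hρ : ∀ a, ρ a = (coinWeight p false)⁻¹ • (κ a - coinWeight p true • η a) := fun a => rfl
  refine ⟨ρ, ⟨fun a => ⟨?_⟩⟩, fun a => ?_⟩
  · have hsub : 1 - coinWeight p true = coinWeight p false := by
      rw [← coinWeight_add p, ENNReal.add_sub_cancel_left (coinWeight_ne_top p true)]
    rw [hρ, Measure.smul_apply, hdiff a _ .univ, measure_univ, measure_univ, mul_one, hsub,
      smul_eq_mul, ENNReal.inv_mul_cancel hq (coinWeight_ne_top p false)]
  · rw [hρ, smul_smul, ENNReal.mul_inv_cancel hq (coinWeight_ne_top p false), one_smul, add_comm,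
      Measure.sub_add_cancel_of_le (h a)]

theorem eq_coinWeight_mixture_of_residuals {μ₀ μ₁ ν₀ ν₁ : Measure β} [IsFiniteMeasure μ₀]
    [IsFiniteMeasure μ₁] [IsFiniteMeasure ν₀] [IsFiniteMeasure ν₁] {p f : I}
    (hf : (f : ℝ) * (1 + p) = 1) (hp : p ≠ 1)
    (h₀ : μ₀ = coinWeight p true • μ₁ + coinWeight p false • ν₀)
    (h₁ : μ₁ = coinWeight p true • μ₀ + coinWeight p false • ν₁) :
    μ₀ = coinWeight f true • ν₀ + coinWeight f false • ν₁ := by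
  have hreal : ∀ (q : I) (μ ν : Measure β) [IsFiniteMeasure μ] [IsFiniteMeasure ν] (E : Set β),
      (coinWeight q true • μ + coinWeight q false • ν).real E =
        q * μ.real E + (1 - q) * ν.real E := fun q μ ν _ _ E => by
    have := μ.smul_finite (coinWeight_ne_top q true)
    have := ν.smul_finite (coinWeight_ne_top q false)
    rw [measureReal_add_apply, measureReal_ennreal_smul_apply, measureReal_ennreal_smul_apply,
      toReal_coinWeight_true, toReal_coinWeight_false]
  have := ν₀.smul_finite (coinWeight_ne_top f true)
  have := ν₁.smul_finite (coinWeight_ne_top f false)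
  have hp' : (1 - p : ℝ) ≠ 0 := sub_ne_zero.2 fun h => hp (Subtype.ext h.symm)
  refine Measure.ext fun E _ => (measureReal_eq_measureReal_iff).1 (mul_left_cancel₀ hp' ?_)
  have h₀E := congrArg (fun μ => μ.real E) h₀
  have h₁E := congrArg (fun μ => μ.real E) h₁
  simp only [hreal] at h₀E h₁E ⊢
  linear_combination (f : ℝ) * h₀E + (1 - f) * h₁E - (μ₀.real E - μ₁.real E) * hf

theorem exists_extremal_kernels {κ₀ κ₁ : Kernel α β} [IsMarkovKernel κ₀] [IsMarkovKernel κ₁]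
    {p f : I} (hf : (f : ℝ) * (1 + p) = 1) (h₀ : ∀ a, coinWeight p true • κ₁ a ≤ κ₀ a)
    (h₁ : ∀ a, coinWeight p true • κ₀ a ≤ κ₁ a) :
    ∃ η : Bool → Kernel α β, (∀ b, IsMarkovKernel (η b)) ∧
      (∀ a, κ₀ a = ∑ b, coinWeight f b • η b a) ∧
      ∀ a, κ₁ a = ∑ b, coinWeight (unitInterval.symm f) b • η b a := by
  obtain rfl | hp := eq_or_ne p 1
  · have heq : ∀ a, κ₀ a = κ₁ a := fun a =>
      Measure.eq_of_le_of_isProbabilityMeasure (by simpa [coinWeight] using h₁ a)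
    refine ⟨fun _ => κ₀, fun _ => inferInstance, fun a => ?_, fun a => ?_⟩
    · rw [← Finset.sum_smul, sum_coinWeight, one_smul]
    · rw [← Finset.sum_smul, sum_coinWeight, one_smul, heq]
  obtain ⟨η₀, hη₀, e₀⟩ := exists_residual_kernel h₀
  obtain ⟨η₁, hη₁, e₁⟩ := exists_residual_kernel h₁
  refine ⟨fun b => bif b then η₀ else η₁, Bool.forall_bool.2 ⟨hη₁, hη₀⟩, fun a => ?_, fun a => ?_⟩
  · simp only [Fintype.sum_bool, cond_true, cond_false]
    exact eq_coinWeight_mixture_of_residuals hf hp (e₀ a) (e₁ a)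
  · simp only [Fintype.sum_bool, cond_true, cond_false, coinWeight_symm]
    rw [add_comm]
    exact eq_coinWeight_mixture_of_residuals hf hp (e₁ a) (e₀ a)

theorem coinWeight_halfProb (b : Bool) : coinWeight halfProb b = 2⁻¹ := by
  cases b <;> simp [coinWeight, halfProb, ← one_div, sub_half, ENNReal.ofReal_div_of_pos]

theorem exists_clone_decomposition {D : Type*} {M : D → Kernel α β} [∀ x, IsMarkovKernel (M x)]
    {p f : I} (hf : (f : ℝ) * (1 + p) = 1) (h : ∀ x x' a, coinWeight p true • M x a ≤ M x' a)
    (x₀ x₁ : D) :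
    ∃ R : Bool ⊕ D → Kernel α β, (∀ y, IsMarkovKernel (R y)) ∧
      (∀ x a, M x₀ a = ∑ t, letterWeight 1 f t • R (t.elim (Sum.inr x) Sum.inl) a) ∧
      (∀ x a, M x₁ a =
        ∑ t, letterWeight 1 (unitInterval.symm f) t • R (t.elim (Sum.inr x) Sum.inl) a) ∧
      ∀ x a, M x a = ∑ t, letterWeight p halfProb t • R (t.elim (Sum.inr x) Sum.inl) a := by
  obtain ⟨η, hη, e₀, e₁⟩ := exists_extremal_kernels hf (fun a => h x₁ x₀ a) (fun a => h x₀ x₁ a)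
  obtain ⟨μ, hμ, eμ⟩ := exists_kernel_eq_sum_smul (sum_coinWeight halfProb) η
  have hsum : ∀ a, η true a + η false a = M x₀ a + M x₁ a := fun a => by
    rw [e₀, e₁, Fintype.sum_bool, Fintype.sum_bool, coinWeight_symm, coinWeight_symm,
      add_add_add_comm, ← add_smul, ← add_smul, Bool.not_true, Bool.not_false, coinWeight_add,
      add_comm (coinWeight f false), coinWeight_add, one_smul, one_smul]
  have hμle : ∀ x a, coinWeight p true • μ a ≤ M x a := fun x a => by
    rw [eμ, Fintype.sum_bool, coinWeight_halfProb, coinWeight_halfProb, ← smul_add, hsum,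
      smul_comm, smul_add]
    calc (2⁻¹ : ℝ≥0∞) • (coinWeight p true • M x₀ a + coinWeight p true • M x₁ a)
      _ ≤ (2⁻¹ : ℝ≥0∞) • (M x a + M x a) := by
        gcongr
        exacts [h x₀ x a, h x₁ x a]
      _ = M x a := by
        rw [smul_add, ← add_smul, ENNReal.inv_two_add_inv_two, one_smul]
  choose ρ hρ eρ using fun x => exists_residual_kernel (hμle x)
  refine ⟨Sum.elim η ρ, Sum.rec hη hρ, fun x a => ?_, fun x a => ?_, fun x a => ?_⟩
  · simp [e₀ a, Fintype.sum_option, letterWeight_one_none, letterWeight_one_some]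
  · simp [e₁ a, Fintype.sum_option, letterWeight_one_none, letterWeight_one_some]
  · rw [eρ x a, eμ a, Fintype.sum_option, add_comm, Finset.smul_sum]
    simp only [letterWeight, smul_smul]
    rfl

theorem IsLDP.coinWeight_smul_le {D Ω : Type*} [MeasurableSpace Ω] {ε₀ : ℝ≥0} {M : D → Measure Ω}
    (h : IsLDP ε₀ M) (x x' : D) : coinWeight (cloneProb ε₀) true • M x ≤ M x' := by
  refine Measure.le_intro fun E hE _ => ?_
  rw [Measure.smul_apply, smul_eq_mul]
  calc coinWeight (cloneProb ε₀) true * M x E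
      ≤ ENNReal.ofReal (Real.exp (-ε₀)) * (ENNReal.ofReal (Real.exp ε₀) * M x' E) :=
        mul_le_mul_right (h x x' E hE) _
    _ = M x' E := by
        rw [← mul_assoc, ← ENNReal.ofReal_mul (Real.exp_pos _).le, ← Real.exp_add,
          neg_add_cancel, Real.exp_zero, ENNReal.ofReal_one, one_mul]

theorem flipProb_mul_one_add_cloneProb (ε₀ : ℝ≥0) :
    (flipProb ε₀ : ℝ) * (1 + cloneProb ε₀) = 1 :=
  one_div_mul_cancel (add_pos one_pos (Real.exp_pos _)).ne'

end CloneDecomposition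

/-! ### Shuffled processes as images of the count laws -/

section Shuffling

theorem exists_kernel_forall_mem_eq {ι α Ω : Type*} [MeasurableSpace α] [DiscreteMeasurableSpace α]
    [MeasurableSpace Ω] [Nonempty Ω] (L : ι → Measure Ω) [∀ i, IsProbabilityMeasure (L i)]
    (c : ι → α) (s : Set ι) (h : ∀ i ∈ s, ∀ j ∈ s, c i = c j → L i = L j) :
    ∃ κ : Kernel α Ω, IsMarkovKernel κ ∧ ∀ i ∈ s, κ (c i) = L i := by
  classical
  let κ : Kernel α Ω :=
    ⟨fun a => if ha : ∃ i ∈ s, c i = a then L ha.choose else Measure.dirac (Classical.arbitrary Ω),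
      Measurable.of_discrete⟩
  refine ⟨κ, ⟨fun a => ?_⟩, fun i hi => ?_⟩
  · change IsProbabilityMeasure (dite _ _ _)
    split_ifs <;> infer_instance
  · have ha : ∃ j ∈ s, c j = c i := ⟨i, hi, rfl⟩
    exact (dif_pos ha).trans (h _ ha.choose_spec.1 i hi ha.choose_spec.2)

theorem comp_sum_smul_dirac {ι α Ω : Type*} [Fintype ι] [MeasurableSpace α] [MeasurableSpace Ω]
    (κ : Kernel α Ω) (w : ι → ℝ≥0∞) (c : ι → α) :
    κ ∘ₘ (∑ i, w i • Measure.dirac (c i)) = ∑ i, w i • κ (c i) := by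
  refine Measure.ext fun E hE => ?_
  rw [Measure.bind_apply hE κ.aemeasurable, lintegral_finsetSum_measure, Measure.finsetSum_apply]
  simp only [lintegral_smul_measure, lintegral_dirac' _ (κ.measurable_coe hE), Measure.smul_apply]

theorem wordWeight_eq_zero {m : ℕ} (ε₀ : ℝ≥0) (p : I) {w : Fin (m + 1) → Option Bool}
    (h : w 0 = none) : wordWeight ε₀ p w = 0 := by
  rw [wordWeight, h, letterWeight_one_none, zero_mul]

theorem exists_kernel_shuffledProcess_cons {m : ℕ} {D : Type*} {S : Fin (m + 1) → Type*}
    [∀ i, MeasurableSpace (S i)] {R : (i : Fin (m + 1)) → D → Kernel (Prefix S i i.isLt.le) (S i)}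
    [∀ i x, IsMarkovKernel (R i x)] {ε₀ : ℝ≥0} (hR : ∀ i z, IsLDP ε₀ fun x => R i x z)
    (x₀ x₁ : D) (Y : Fin m → D) :
    ∃ κ : Kernel (ℕ × ℕ) ((i : Fin (m + 1)) → S i), IsMarkovKernel κ ∧
      shuffledProcess R (Fin.cons x₀ Y) = κ ∘ₘ lawP (m + 1) ε₀ ∧
      shuffledProcess R (Fin.cons x₁ Y) = κ ∘ₘ lawQ (m + 1) ε₀ := by
  choose R' hR' e₀ e₁ eR using fun i => exists_clone_decomposition
    (flipProb_mul_one_add_cloneProb ε₀) (fun x x' z => (hR i z).coinWeight_smul_le x x') x₀ x₁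
  have : Nonempty ((i : Fin (m + 1)) → S i) :=
    nonempty_of_isProbabilityMeasure (shuffledProcess R (Fin.cons x₀ Y))
  obtain ⟨κ, hκ, hκw⟩ := exists_kernel_forall_mem_eq (maskedLaw R' x₀ Y) cloneCounts
    {w | w 0 ≠ none} fun w hw w' hw' h => maskedLaw_eq_of_cloneCounts_eq R' x₀ Y hw hw' h
  have hmix : ∀ p, κ ∘ₘ (∑ w, wordWeight ε₀ p w • Measure.dirac (cloneCounts w)) =
      ∑ w : Fin (m + 1) → Option Bool, wordWeight ε₀ p w • maskedLaw R' x₀ Y w := fun p => by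
    rw [comp_sum_smul_dirac]
    refine Finset.sum_congr rfl fun w _ => ?_
    by_cases hw : w 0 = none
    · rw [wordWeight_eq_zero ε₀ p hw, zero_smul, zero_smul]
    · rw [hκw w hw]
  refine ⟨κ, hκ, ?_, ?_⟩
  · rw [lawP_succ, hmix]
    exact shuffledProcess_cons_eq_sum_maskedLaw (fun i z => e₀ i x₀ z) eR
  · rw [lawQ_succ, hmix]
    exact shuffledProcess_cons_eq_sum_maskedLaw (fun i z => e₁ i x₀ z) eR

theorem exists_kernel_shuffledProcess {n : ℕ} {D : Type*} {S : Fin n → Type*}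
    [∀ i, MeasurableSpace (S i)] {R : (i : Fin n) → D → Kernel (Prefix S i i.isLt.le) (S i)}
    [∀ i x, IsMarkovKernel (R i x)] {ε₀ : ℝ≥0} (hR : ∀ i z, IsLDP ε₀ fun x => R i x z)
    {X₀ X₁ : Fin n → D} (hX : Neighbouring X₀ X₁) :
    ∃ κ : Kernel (ℕ × ℕ) ((i : Fin n) → S i), IsMarkovKernel κ ∧
      shuffledProcess R X₀ = κ ∘ₘ lawP n ε₀ ∧ shuffledProcess R X₁ = κ ∘ₘ lawQ n ε₀ := by
  obtain ⟨i, -, hi⟩ := hX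
  obtain _ | m := n
  · exact i.elim0
  have hrest : i.removeNth X₁ = i.removeNth X₀ := funext fun j =>
    (not_imp_comm.1 (hi (i.succAbove j)) (i.succAbove_ne j)).symm
  have hfront : ∀ X : Fin (m + 1) → D,
      shuffledProcess R (Fin.cons (X i) (i.removeNth X)) = shuffledProcess R X := fun X => by
    rw [Fin.cons_removeNth_eq_comp_cycleRange_symm, shuffledProcess_comp_perm]
  rw [← hfront X₀, ← hfront X₁, hrest]
  exact exists_kernel_shuffledProcess_cons hR _ _ _

end Shuffling

end ShuffleRDP

theorem corollary1 {n : ℕ} (hn : 1 ≤ n) {D : Type*} {S : Fin n → Type*}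
    [∀ i, MeasurableSpace (S i)] (ε₀ : ℝ≥0) (lam : ℝ) (hlam : 1 < lam)
    (R : (i : Fin n) → D → Kernel (ShuffleRDP.Prefix S i i.isLt.le) (S i))
    [∀ i x, IsMarkovKernel (R i x)]
    (hR : ∀ (i : Fin n) (z : ShuffleRDP.Prefix S i i.isLt.le),
      ShuffleRDP.IsLDP (ε₀ : ℝ) (fun x => R i x z)) :
    ShuffleRDP.IsRDP lam
      (max (ShuffleRDP.renyiDiv lam (ShuffleRDP.lawP n ε₀) (ShuffleRDP.lawQ n ε₀))
        (ShuffleRDP.renyiDiv lam (ShuffleRDP.lawQ n ε₀) (ShuffleRDP.lawP n ε₀)))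
      (ShuffleRDP.shuffledProcess R) := by
  intro X₀ X₁ hX
  obtain ⟨κ, hκ, h₀, h₁⟩ := ShuffleRDP.exists_kernel_shuffledProcess hR hX
  rw [h₀, h₁]
  exact (ShuffleRDP.renyiDiv_comp_le hlam _ _ κ).trans (le_max_left _ _)
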